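/- Let $n\ge 0$ be an integer, let $T,\epsilon>0$ and let $F:\mathbb R^n\times\mathbb R_{\ge 0}\to 2^{\mathbb R^n}$ be a set-valued map. Consider the differential inclusion $\dot x\in F(x,t)$. Definitions. An interval is a connected set $I\subseteq\mathbb R$ of nonzero Lebesgue measure; suprema of intervals are taken in $\mathbb R\cup\{\infty\}$. Let $S$ be a subset of an interval $I$ and let $g:I\to\mathbb R^n$. The function $g$ is $AC_*$ on $S$ if for each $\eta>0$ there is $\delta>0$ such that $\sum_{i=1}^m\sup_{a,b\in[a_i,b_i]}\|g(b)-g(a)\|<\eta$ for every finite collection of non-overlapping intervals $[a_i,b_i]$ with $a_i,b_i\in S$ and $\sum_{i=1}^m|b_i-a_i|<\delta$. It is $ACG_*$ on $S$ if $g|_S$ is continuous and $S$ is a union of countably many sets on each of which $g$ is $AC_*$. A generalized solution of the inclusion is a function $x:I\to\mathbb R^n$ on an interval $I\subseteq\mathbb R_{\ge 0}$ that is $ACG_*$ on $I$ and satisfies $\dot x(t)\in F(x(t),t)$ for almost every $t\in I$. A generalized solution $x:I\to\mathbb R^n$ is maximal if there is no generalized solution $\bar x:\bar I\to\mathbb R^n$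 with $\bar I\cap I\neq\emptyset$, $\sup\bar I>\sup I$, and $\bar x(t)=x(t)$ for all $t\in I\cap\bar I$. Theorem. Suppose that $F$ is upper semicontinuous on every compact subset of $\mathcal E=\mathbb R^n\times[T,T+\epsilon)$ (that is, for every compact $K\subseteq\mathcal E$, every $p\in K$ and every open $V\supseteq F(p)$, one has $F(q)\subseteq V$ for all $q\in K$ sufficiently close to $p$), and that $F(x,t)$ is nonempty, compact and convex for all $(x,t)\in\mathcal E$. Let $x:I\to\mathbb R^n$ be a maximal generalized solution of $\dot x\in F(x,t)$. If $\sup I\ge T$ and $\lim_{t\to T,\ t\in I\setminus\{T\}}x(t)$ exists, then there exists $\delta>0$ such that $\sup I\ge T+\delta$. -/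

import Mathlib

namespace GenFilippov

/-- The state space `ℝⁿ` with its Euclidean norm. -/
abbrev State (n : ℕ) : Type := EuclideanSpace ℝ (Fin n)

/-- An interval: a connected subset of `ℝ` of nonzero Lebesgue measure. -/
def IsInterval (I : Set ℝ) : Prop :=
  IsConnected I ∧ MeasureTheory.volume I ≠ 0

/-- `g` is absolutely continuous in the restricted sense (AC⁎) on `S`.  The oscillation
`sup {‖g q - g p‖ : p, q ∈ [a i, b i]}` is the extended-real-valued diameter of the image
of `[a i, b i]`, so that an infinite oscillation counts as infinite. -/
def ACStarOn {n : ℕ} (g : ℝ → State n) (S : Set ℝ) : Prop :=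
  ∀ ε : ℝ, 0 < ε → ∃ δ : ℝ, 0 < δ ∧
    ∀ (m : ℕ) (a b : Fin m → ℝ),
      (∀ i, a i < b i ∧ a i ∈ S ∧ b i ∈ S) →
      (Pairwise fun i j => Disjoint (Set.Ioo (a i) (b i)) (Set.Ioo (a j) (b j))) →
      ∑ i, |b i - a i| < δ →
      ∑ i, Metric.ediam (g '' Set.Icc (a i) (b i)) < ENNReal.ofReal ε

/-- `g` is generalized absolutely continuous in the restricted sense (ACG⁎) on `S`. -/
def ACGStarOn {n : ℕ} (g : ℝ → State n) (S : Set ℝ) : Prop :=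
  ContinuousOn g S ∧ ∃ E : ℕ → Set ℝ, S = ⋃ k, E k ∧ ∀ k, ACStarOn g (E k)

/-- The function `x|_I : I → ℝⁿ` is a generalized solution of `ẋ ∈ F(x, t)`.
Only the values of `x` on `I ⊆ [0, ∞)` and the values of `F` at times `t ≥ 0` matter. -/
structure IsGeneralizedSolution {n : ℕ} (F : State n × ℝ → Set (State n))
    (x : ℝ → State n) (I : Set ℝ) : Prop where
  interval : IsInterval I
  nonneg : I ⊆ Set.Ici 0
  acgStar : ACGStarOn x I
  inclusion : ∀ᵐ t ∂MeasureTheory.volume, t ∈ I →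
    ∃ v ∈ F (x t, t), HasDerivWithinAt x v I t

/-- The supremum of a set of reals, taken in `[-∞, ∞]`. -/
noncomputable def supTime (I : Set ℝ) : EReal := sSup ((fun t : ℝ => (t : EReal)) '' I)

/-- `x|_I` is a maximal generalized solution: no generalized solution that agrees with it on
a nonempty common domain reaches further to the right. -/
def IsMaximalGeneralizedSolution {n : ℕ} (F : State n × ℝ → Set (State n))
    (x : ℝ → State n) (I : Set ℝ) : Prop :=
  IsGeneralizedSolution F x I ∧
    ¬ ∃ (y : ℝ → State n) (J : Set ℝ), IsGeneralizedSolution F y J ∧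
      (J ∩ I).Nonempty ∧ supTime I < supTime J ∧ ∀ t ∈ I ∩ J, x t = y t

end GenFilippov

/-!
If `I` reached no further than `T`, then `x` would extend continuously to `T` by its limit `l`, and
it would suffice to continue it by a Lipschitz solution starting from `l` at time `T`. Such a
solution is obtained without a measurable or continuous selection: take any bounded selection `f`
of `F` near `(l, T)`. Its Euler paths converge along an ultrafilter of steps `h → 0+` to a Lipschitz
curve `z`. The difference quotients of the Euler paths are averages of values of `f` near
`(z t, t)`, so by upper semicontinuity they lie in a closed convex neighbourhood of `F (z t, t)`,
and so does the derivative of `z` wherever it exists, which is almost everywhere.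
-/

open Filter Topology Set
open scoped NNReal

namespace GenFilippov

section Euler

variable {E : Type*} [NormedAddCommGroup E] [NormedSpace ℝ E] {f : E × ℝ → E} {T h : ℝ} {l : E}

/-- The nodes of the explicit Euler scheme with step `h` for `ẋ = f (x, t)`, `x T = l`; the `k`-th
node belongs to the time `T + k * h`. -/
noncomputable def eulerNode (f : E × ℝ → E) (T : ℝ) (l : E) (h : ℝ) : ℕ → E
  | 0 => l
  | k + 1 => eulerNode f T l h k + h • f (eulerNode f T l h k, T + k * h)

/-- The piecewise constant interpolation of the Euler nodes. For `t < T` the natural floor is `0`,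
so the path is then constantly `l`. -/
noncomputable def eulerPath (f : E × ℝ → E) (T : ℝ) (l : E) (h t : ℝ) : E :=
  eulerNode f T l h ⌊(t - T) / h⌋₊

lemma eulerPath_initial : eulerPath f T l h T = l := by
  simp [eulerPath, eulerNode]

lemma eulerPath_gridTime (hh : 0 < h) (k : ℕ) :
    eulerPath f T l h (T + k * h) = eulerNode f T l h k := by
  simp [eulerPath, hh.ne']

lemma eulerNode_sub {j i : ℕ} (hji : j ≤ i) :
    eulerNode f T l h i - eulerNode f T l h j =
      h • ∑ k ∈ Finset.Ico j i, f (eulerNode f T l h k, T + k * h) := by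
  induction i, hji using Nat.le_induction with
  | base => simp
  | succ i hji ih =>
    rw [Finset.sum_Ico_succ_top hji, smul_add, ← ih, eulerNode]
    abel

lemma average_eulerNode_mem (hh : 0 < h) {j i : ℕ} (hji : j < i) {C : Set E} (hC : Convex ℝ C)
    (hmem : ∀ k, j ≤ k → k < i → f (eulerNode f T l h k, T + k * h) ∈ C) :
    (h * ((i : ℝ) - j))⁻¹ • (eulerNode f T l h i - eulerNode f T l h j) ∈ C := by
  have hpos : (0 : ℝ) < (i : ℝ) - j := sub_pos.2 (by exact_mod_cast hji)
  rw [eulerNode_sub hji.le, smul_smul, mul_inv, mul_right_comm, inv_mul_cancel₀ hh.ne', one_mul,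
    Finset.smul_sum]
  refine hC.sum_mem (fun _ _ => by positivity) ?_ fun k hk => ?_
  · simp [Nat.cast_sub hji.le, hpos.ne']
  · exact hmem k (Finset.mem_Ico.1 hk).1 (Finset.mem_Ico.1 hk).2

lemma norm_eulerNode_sub_le {M : ℝ} (hf : ∀ q, ‖f q‖ ≤ M) (hh : 0 ≤ h) {j i : ℕ} (hji : j ≤ i) :
    ‖eulerNode f T l h i - eulerNode f T l h j‖ ≤ M * (h * ((i : ℝ) - j)) := by
  rw [eulerNode_sub hji, norm_smul, Real.norm_of_nonneg hh]
  have hsum : ‖∑ k ∈ Finset.Ico j i, f (eulerNode f T l h k, T + k * h)‖ ≤ ((i : ℝ) - j) * M := by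
    refine (norm_sum_le_of_le _ fun k _ => hf _).trans ?_
    simp [Nat.cast_sub hji]
  calc _ ≤ h * (((i : ℝ) - j) * M) := by gcongr
    _ = _ := by ring

lemma mul_floor_sub_floor_le {a b h : ℝ} (hh : 0 < h) (hab : a ≤ b) :
    h * ((⌊b / h⌋₊ : ℝ) - ⌊a / h⌋₊) ≤ b - a + h := by
  have hle : (⌊b / h⌋₊ : ℝ) - ⌊a / h⌋₊ ≤ b / h - a / h + 1 := by
    have ha : a / h < ⌊a / h⌋₊ + 1 := Nat.lt_floor_add_one _
    have hdiv : a / h ≤ b / h := by gcongr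
    rcases le_or_gt 0 (b / h) with hb | hb
    · linarith [Nat.floor_le hb]
    · rw [Nat.floor_of_nonpos hb.le, Nat.floor_of_nonpos (hdiv.trans hb.le)]
      linarith
  calc _ ≤ h * (b / h - a / h + 1) := by gcongr
    _ = b - a + h := by field_simp

lemma tendsto_mul_floor_div {a : ℝ} (ha : 0 ≤ a) :
    Tendsto (fun h : ℝ => h * (⌊a / h⌋₊ : ℝ)) (𝓝[>] 0) (𝓝 a) := by
  refine ((tendsto_nat_floor_mul_div_atTop ha).comp tendsto_inv_nhdsGT_zero).congr fun h => ?_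
  simp [div_eq_mul_inv, mul_comm]

lemma dist_eulerPath_le {M : ℝ≥0} (hf : ∀ q, ‖f q‖ ≤ M) (hh : 0 < h) (s t : ℝ) :
    dist (eulerPath f T l h s) (eulerPath f T l h t) ≤ M * (dist s t + h) := by
  wlog hts : t ≤ s generalizing s t
  · simpa only [dist_comm] using this t s (le_of_not_ge hts)
  rw [dist_eq_norm, Real.dist_eq, abs_of_nonneg (sub_nonneg.2 hts)]
  refine (norm_eulerNode_sub_le hf hh.le (Nat.floor_le_floor (by gcongr))).trans ?_
  gcongr
  simpa using mul_floor_sub_floor_le hh (sub_le_sub_right hts T)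

/-- `x` is the pointwise limit of the Euler paths with step `h → 0+` along the filter `L`. A filter
is used in place of a sequence of steps so that the paths converge along any ultrafilter. -/
structure IsEulerLimit (f : E × ℝ → E) (T : ℝ) (l : E) (L : Filter ℝ) (x : ℝ → E) : Prop where
  le_nhdsGT : L ≤ 𝓝[>] 0
  tendsto : ∀ t, Tendsto (fun h => eulerPath f T l h t) L (𝓝 (x t))

theorem exists_isEulerLimit [ProperSpace E] {M : ℝ≥0} (hf : ∀ q, ‖f q‖ ≤ M) {U : Ultrafilter ℝ}
    (hU : (U : Filter ℝ) ≤ 𝓝[>] 0) : ∃ x, IsEulerLimit f T l U x := by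
  suffices h : ∀ t, ∃ y, Tendsto (fun h => eulerPath f T l h t) U (𝓝 y) by
    choose x hx using h
    exact ⟨x, hU, hx⟩
  intro t
  have hbdd : ∀ᶠ h in (U : Filter ℝ),
      eulerPath f T l h t ∈ Metric.closedBall l (M * (dist t T + 1)) := by
    filter_upwards [hU (Ioc_mem_nhdsGT one_pos)] with h hh
    have hdist := dist_eulerPath_le (T := T) (l := l) hf hh.1 t T
    rw [eulerPath_initial] at hdist
    refine hdist.trans ?_
    gcongr
    exact hh.2
  obtain ⟨y, -, hy⟩ := (isCompact_closedBall l (M * (dist t T + 1))).ultrafilter_le_nhds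
    (U.map fun h => eulerPath f T l h t) (le_principal_iff.2 hbdd)
  exact ⟨y, hy⟩

namespace IsEulerLimit

variable {L : Filter ℝ} {x : ℝ → E} {M : ℝ≥0}

lemma eventually_pos (hx : IsEulerLimit f T l L x) : ∀ᶠ h in L, 0 < h :=
  hx.le_nhdsGT self_mem_nhdsWithin

lemma tendsto_step (hx : IsEulerLimit f T l L x) : Tendsto id L (𝓝 0) :=
  hx.le_nhdsGT.trans nhdsWithin_le_nhds

lemma apply_initial [L.NeBot] (hx : IsEulerLimit f T l L x) : x T = l :=
  tendsto_nhds_unique (hx.tendsto T) (by simp only [eulerPath_initial, tendsto_const_nhds])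

lemma lipschitzWith [L.NeBot] (hx : IsEulerLimit f T l L x) (hf : ∀ q, ‖f q‖ ≤ M) :
    LipschitzWith M x := by
  refine LipschitzWith.of_dist_le_mul fun s t => ?_
  have hbound : Tendsto (fun h => M * (dist s t + h)) L (𝓝 (M * (dist s t + 0))) :=
    (hx.tendsto_step.const_add _).const_mul _
  rw [add_zero] at hbound
  refine le_of_tendsto_of_tendsto ((hx.tendsto s).dist (hx.tendsto t)) hbound ?_
  filter_upwards [hx.eventually_pos] with h hh using dist_eulerPath_le hf hh s t

lemma tendsto_prod (hx : IsEulerLimit f T l L x) (hf : ∀ q, ‖f q‖ ≤ M) (t : ℝ) :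
    Tendsto (fun p : ℝ × ℝ => eulerPath f T l p.2 p.1) (𝓝 t ×ˢ L) (𝓝 (x t)) := by
  have hbound : Tendsto (fun p : ℝ × ℝ => M * (dist t p.1 + p.2)) (𝓝 t ×ˢ L)
      (𝓝 (M * (dist t t + 0))) :=
    ((tendsto_const_nhds.dist tendsto_fst).add (hx.tendsto_step.comp tendsto_snd)).const_mul _
  rw [dist_self, add_zero, mul_zero] at hbound
  refine ((hx.tendsto t).comp tendsto_snd).congr_dist
    (squeeze_zero' (Eventually.of_forall fun _ => dist_nonneg) ?_ hbound)
  filter_upwards [tendsto_snd.eventually hx.eventually_pos] with p hp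
    using dist_eulerPath_le hf hp t p.1

lemma eventually_eulerNode_mem (hx : IsEulerLimit f T l L x) (hf : ∀ q, ‖f q‖ ≤ M) {t : ℝ}
    {V : Set (E × ℝ)} (hV : V ∈ 𝓝 (x t, t)) :
    ∀ᶠ s in 𝓝[>] t, ∀ᶠ h in L, ∀ k : ℕ, ⌊(t - T) / h⌋₊ ≤ k → k < ⌊(s - T) / h⌋₊ →
      (eulerNode f T l h k, T + k * h) ∈ V := by
  have hpath : ∀ᶠ p in 𝓝 t ×ˢ L, (eulerPath f T l p.2 p.1, p.1) ∈ V :=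
    ((hx.tendsto_prod hf t).prodMk_nhds tendsto_fst).eventually hV
  obtain ⟨A, hA, B, hB, hAB⟩ := eventually_prod_iff.1 hpath
  obtain ⟨ρ, hρ, hρA⟩ := Metric.eventually_nhds_iff_ball.1 hA
  filter_upwards [Ioo_mem_nhdsGT (lt_add_of_pos_right t hρ)] with s hs
  filter_upwards [hB, hx.eventually_pos, hx.tendsto_step.eventually_lt_const hρ]
    with h hhB hh hhρ k hjk hki
  have hlower : t - h < T + k * h := by
    have hfloor : (t - T) / h < k + 1 :=
      (Nat.lt_floor_add_one _).trans_le (by gcongr)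
    rw [div_lt_iff₀ hh] at hfloor
    linarith
  have hupper : T + k * h < s := by
    have hfloor : (k : ℝ) < (s - T) / h := Nat.lt_of_lt_floor hki
    rw [lt_div_iff₀ hh] at hfloor
    linarith
  rw [← eulerPath_gridTime hh]
  refine hAB (hρA _ ?_) hhB
  rw [Real.ball_eq_Ioo]
  exact ⟨by linarith [show h < ρ from hhρ], hupper.trans hs.2⟩

lemma slope_mem [L.NeBot] (hx : IsEulerLimit f T l L x) {t s : ℝ} (hTt : T ≤ t) (hts : t < s)
    {C : Set E} (hCc : IsClosed C) (hC : Convex ℝ C)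
    (hmem : ∀ᶠ h in L, ∀ k : ℕ, ⌊(t - T) / h⌋₊ ≤ k → k < ⌊(s - T) / h⌋₊ →
      f (eulerNode f T l h k, T + k * h) ∈ C) :
    slope x t s ∈ C := by
  have hst : 0 < s - t := sub_pos.2 hts
  have htime : Tendsto (fun h : ℝ => h * ((⌊(s - T) / h⌋₊ : ℝ) - ⌊(t - T) / h⌋₊)) L
      (𝓝 (s - t)) := by
    have hdiff := ((tendsto_mul_floor_div (sub_nonneg.2 (hTt.trans hts.le))).sub
      (tendsto_mul_floor_div (sub_nonneg.2 hTt))).mono_left hx.le_nhdsGT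
    simpa only [mul_sub, sub_sub_sub_cancel_right] using hdiff
  rw [slope_def_module]
  refine hCc.mem_of_tendsto ((htime.inv₀ hst.ne').smul ((hx.tendsto s).sub (hx.tendsto t))) ?_
  filter_upwards [hx.eventually_pos, htime.eventually_const_lt hst, hmem] with h hh hpos hk
  have hji : ⌊(t - T) / h⌋₊ < ⌊(s - T) / h⌋₊ := by
    exact_mod_cast sub_pos.1 ((mul_pos_iff_of_pos_left hh).1 hpos)
  exact average_eulerNode_mem hh hji hC hk

theorem rightDeriv_mem [L.NeBot] (hx : IsEulerLimit f T l L x) (hf : ∀ q, ‖f q‖ ≤ M) {t : ℝ}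
    (hTt : T ≤ t) {v : E} (hv : HasDerivWithinAt x v (Ioi t) t) {C : Set E} (hCc : IsClosed C)
    (hC : Convex ℝ C) (hfC : ∀ᶠ q in 𝓝 (x t, t), f q ∈ C) : v ∈ C := by
  have hslope := (hasDerivWithinAt_iff_tendsto_slope' self_notMem_Ioi).1 hv
  refine hCc.mem_of_tendsto hslope ?_
  filter_upwards [hx.eventually_eulerNode_mem hf hfC, self_mem_nhdsWithin] with s hs hts
    using hx.slope_mem hTt hts hCc hC hs

theorem rightDeriv_mem_of_upperHemicontinuousAt [L.NeBot] (hx : IsEulerLimit f T l L x)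
    (hf : ∀ q, ‖f q‖ ≤ M) {t : ℝ} (hTt : T ≤ t) {v : E} (hv : HasDerivWithinAt x v (Ioi t) t)
    {F : E × ℝ → Set E} (hF : UpperHemicontinuousAt F (x t, t))
    (hfF : ∀ᶠ q in 𝓝 (x t, t), f q ∈ F q) (hclosed : IsClosed (F (x t, t)))
    (hconv : Convex ℝ (F (x t, t))) : v ∈ F (x t, t) := by
  rw [← hclosed.closure_eq, Metric.closure_eq_iInter_cthickening]
  refine mem_iInter₂.2 fun η hη => ?_
  refine hx.rightDeriv_mem hf hTt hv Metric.isClosed_cthickening (hconv.cthickening η) ?_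
  filter_upwards [hfF, hF.forall_isOpen _ Metric.isOpen_thickening
    (Metric.self_subset_thickening hη _)] with q hq hqF
    using Metric.thickening_subset_cthickening _ _ (hqF hq)

end IsEulerLimit

end Euler

section LocalExistence

lemma isBounded_biUnion_of_upperHemicontinuousOn {X E : Type*} [TopologicalSpace X]
    [PseudoMetricSpace E] {F : X → Set E} {K : Set X} (hK : IsCompact K)
    (hF : UpperHemicontinuousOn F K) (hb : ∀ p ∈ K, Bornology.IsBounded (F p)) :
    Bornology.IsBounded (⋃ p ∈ K, F p) := by
  refine hK.induction_on (p := fun s => Bornology.IsBounded (⋃ p ∈ s, F p)) (by simp)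
    (fun s t hst ht => ht.subset (biUnion_subset_biUnion_left hst)) (fun s t hs ht => ?_)
    fun p hp => ?_
  · rw [biUnion_union]
    exact hs.union ht
  · exact ⟨_, hF.forall_isOpen p hp _ Metric.isOpen_thickening
      (Metric.self_subset_thickening one_pos _),
      ((hb p hp).thickening (δ := 1)).subset (iUnion₂_subset fun q hq => hq)⟩

lemma exists_bounded_selection {X E : Type*} [TopologicalSpace X] [NormedAddCommGroup E]
    {F : X → Set E} {K : Set X} (hK : IsCompact K) (hF : UpperHemicontinuousOn F K)
    (hne : ∀ p ∈ K, (F p).Nonempty) (hb : ∀ p ∈ K, Bornology.IsBounded (F p)) :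
    ∃ (f : X → E) (M : ℝ≥0), (∀ p ∈ K, f p ∈ F p) ∧ ∀ p, ‖f p‖ ≤ M := by
  classical
  obtain ⟨C, hC⟩ := (isBounded_biUnion_of_upperHemicontinuousOn hK hF hb).exists_norm_le
  choose! g hg using hne
  refine ⟨K.indicator g, C.toNNReal, fun p hp => ?_, fun p => ?_⟩
  · rw [indicator_of_mem hp]
    exact hg p hp
  · by_cases hp : p ∈ K
    · rw [indicator_of_mem hp]
      exact (hC _ (mem_biUnion hp (hg p hp))).trans C.le_coe_toNNReal
    · simp [hp]

theorem exists_lipschitzWith_solution {E : Type*} [NormedAddCommGroup E] [NormedSpace ℝ E]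
    [FiniteDimensional ℝ E] {F : E × ℝ → Set E} {T : ℝ} {l : E} {K : Set (E × ℝ)}
    (hK : IsCompact K) (hKn : K ∈ 𝓝[univ ×ˢ Ioi T] (l, T)) (huhc : UpperHemicontinuousOn F K)
    (hval : ∀ p ∈ K, (F p).Nonempty ∧ IsCompact (F p) ∧ Convex ℝ (F p)) :
    ∃ c > T, ∃ (M : ℝ≥0) (z : ℝ → E), LipschitzWith M z ∧ z T = l ∧
      ∀ᵐ t, t ∈ Ioo T c → ∃ v ∈ F (z t, t), HasDerivAt z v t := by
  have : ProperSpace E := FiniteDimensional.proper ℝ E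
  obtain ⟨f, M, hfF, hf⟩ := exists_bounded_selection hK huhc (fun p hp => (hval p hp).1)
    fun p hp => (hval p hp).2.1.isBounded
  obtain ⟨z, hz⟩ := exists_isEulerLimit (T := T) (l := l) hf (Ultrafilter.of_le (𝓝[>] (0 : ℝ)))
  have hlip : LipschitzWith M z := hz.lipschitzWith hf
  have hstay : ∀ᶠ t in 𝓝[>] T, K ∈ 𝓝 (z t, t) := by
    have hzT : Tendsto (fun t => (z t, t)) (𝓝[>] T) (𝓝[univ ×ˢ Ioi T] (l, T)) := by
      rw [nhdsWithin_prod_eq, nhdsWithin_univ, ← hz.apply_initial]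
      exact (hlip.continuous.continuousAt.mono_left nhdsWithin_le_nhds).prodMk tendsto_id
    filter_upwards [hzT.eventually (eventually_eventually_nhdsWithin.2 hKn), self_mem_nhdsWithin]
      with t ht hTt
    rwa [(isOpen_univ.prod isOpen_Ioi).nhdsWithin_eq ⟨mem_univ _, hTt⟩] at ht
  obtain ⟨c, hTc, hc⟩ := mem_nhdsGT_iff_exists_Ioo_subset.1 hstay
  refine ⟨c, hTc, M, z, hlip, hz.apply_initial, ?_⟩
  filter_upwards [hlip.ae_differentiableAt_real] with t hdiff ht
  have hKt : K ∈ 𝓝 (z t, t) := hc ht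
  have htK : (z t, t) ∈ K := mem_of_mem_nhds hKt
  have hF : UpperHemicontinuousAt F (z t, t) := by
    simpa only [UpperHemicontinuousWithinAt, UpperHemicontinuousAt, SemicontinuousWithinAt,
      SemicontinuousAt, nhdsWithin_eq_nhds.2 hKt] using huhc _ htK
  exact ⟨deriv z t, hz.rightDeriv_mem_of_upperHemicontinuousAt hf ht.1.le
    hdiff.hasDerivAt.hasDerivWithinAt hF (mem_of_superset hKt hfF) (hval _ htK).2.1.isClosed
    (hval _ htK).2.2, hdiff.hasDerivAt⟩

end LocalExistence

section ACStar

variable {n : ℕ} {g g' : ℝ → State n} {S S' : Set ℝ}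

lemma ACStarOn.mono (h : ACStarOn g S) (hS : S' ⊆ S) : ACStarOn g S' := fun ε hε => by
  obtain ⟨δ, hδ, H⟩ := h ε hε
  exact ⟨δ, hδ, fun m a b hab => H m a b fun i => ⟨(hab i).1, hS (hab i).2.1, hS (hab i).2.2⟩⟩

/-- `AC⁎` on `S` involves the values between the points of `S`, hence the order-connected `S'`. -/
lemma ACStarOn.congr (h : ACStarOn g S) (hS' : S'.OrdConnected) (hS : S ⊆ S')
    (hg : EqOn g' g S') : ACStarOn g' S := fun ε hε => by
  obtain ⟨δ, hδ, H⟩ := h ε hε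
  refine ⟨δ, hδ, fun m a b hab hd hs => ?_⟩
  have himage : ∀ i, g' '' Icc (a i) (b i) = g '' Icc (a i) (b i) := fun i =>
    (hg.mono (hS'.out (hS (hab i).2.1) (hS (hab i).2.2))).image_eq
  simpa only [himage] using H m a b hab hd hs

lemma acStarOn_of_lipschitzOnWith {M : ℝ≥0} (hg : LipschitzOnWith M g S) (hS : S.OrdConnected) :
    ACStarOn g S := fun ε hε => by
  refine ⟨ε / (M + 1), by positivity, fun m a b hab _ hs => ?_⟩
  have hediam : ∀ i, Metric.ediam (g '' Icc (a i) (b i)) ≤ M * ENNReal.ofReal |b i - a i| := by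
    intro i
    have hsub : Icc (a i) (b i) ⊆ S := hS.out (hab i).2.1 (hab i).2.2
    refine Metric.ediam_image_le_iff.2 fun p hp q hq => (hg (hsub hp) (hsub hq)).trans ?_
    gcongr
    calc edist p q ≤ Metric.ediam (Icc (a i) (b i)) := Metric.edist_le_ediam_of_mem hp hq
      _ = ENNReal.ofReal (b i - a i) := Real.ediam_Icc _ _
      _ ≤ ENNReal.ofReal |b i - a i| := ENNReal.ofReal_le_ofReal (le_abs_self _)
  calc ∑ i, Metric.ediam (g '' Icc (a i) (b i))
      ≤ ∑ i, (M : ENNReal) * ENNReal.ofReal |b i - a i| := Finset.sum_le_sum fun i _ => hediam i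
    _ = ENNReal.ofReal (M * ∑ i, |b i - a i|) := by
        rw [← Finset.mul_sum, ← ENNReal.ofReal_sum_of_nonneg fun _ _ => abs_nonneg _,
          ENNReal.ofReal_mul M.coe_nonneg, ENNReal.ofReal_coe_nnreal]
    _ < ENNReal.ofReal ε := by
        rw [ENNReal.ofReal_lt_ofReal_iff hε]
        calc (M : ℝ) * ∑ i, |b i - a i| ≤ M * (ε / (M + 1)) := by gcongr
          _ = ε * (M / (M + 1)) := by ring
          _ < ε := mul_lt_of_lt_one_right hε ((div_lt_one (by positivity)).2 (lt_add_one _))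

lemma ACGStarOn.mono (h : ACGStarOn g S) (hS : S' ⊆ S) : ACGStarOn g S' := by
  obtain ⟨hcont, E, rfl, hE⟩ := h
  refine ⟨hcont.mono hS, fun k => S' ∩ E k, ?_, fun k => (hE k).mono inter_subset_right⟩
  rw [← inter_iUnion, inter_eq_self_of_subset_left hS]

lemma ACGStarOn.congr (h : ACGStarOn g S) (hS : S.OrdConnected) (hg : EqOn g' g S) :
    ACGStarOn g' S := by
  obtain ⟨hcont, E, rfl, hE⟩ := h
  exact ⟨hcont.congr hg, E, rfl, fun k => (hE k).congr hS (subset_iUnion E k) hg⟩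

lemma acgStarOn_of_lipschitzOnWith {M : ℝ≥0} (hg : LipschitzOnWith M g S)
    (hS : S.OrdConnected) : ACGStarOn g S :=
  ⟨hg.continuousOn, fun _ => S, (iUnion_const S).symm, fun _ => acStarOn_of_lipschitzOnWith hg hS⟩

lemma ACGStarOn.union (h : ACGStarOn g S) (h' : ACGStarOn g S')
    (hcont : ContinuousOn g (S ∪ S')) : ACGStarOn g (S ∪ S') := by
  obtain ⟨-, E, rfl, hE⟩ := h
  obtain ⟨-, E', rfl, hE'⟩ := h'
  have hsum : ∀ i, ACStarOn g (Sum.elim E E' i) := Sum.forall.2 ⟨hE, hE'⟩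
  refine ⟨hcont, fun k => Sum.elim E E' (Equiv.natSumNatEquivNat.symm k), ?_, fun k => hsum _⟩
  rw [Equiv.natSumNatEquivNat.symm.surjective.iUnion_comp (Sum.elim E E'), iUnion_sumElim]

end ACStar

section GeneralizedSolution

lemma continuousOn_piecewise_Iio {X : Type*} [TopologicalSpace X] {x z : ℝ → X} {a T c : ℝ}
    (hx : ContinuousOn x (Ico a T)) (hz : ContinuousOn z (Ico T c))
    (hlim : Tendsto x (𝓝[<] T) (𝓝 (z T))) :
    ContinuousOn ((Iio T).piecewise x z) (Ico a c) := by
  have hleft : Ico a c ∩ Iio T ⊆ Ico a T := fun s hs => ⟨hs.1.1, hs.2⟩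
  have hright : Ico a c ∩ (Iio T)ᶜ ⊆ Ico T c := fun s hs => ⟨not_lt.1 hs.2, hs.1.2⟩
  refine ContinuousOn.piecewise' (fun t ht => ?_) (fun t ht => ?_) (hx.mono hleft) (hz.mono hright)
    <;> obtain rfl : t = T := by simpa using ht.2
  · rw [piecewise_eq_of_notMem _ _ _ self_notMem_Iio]
    exact hlim.mono_left (nhdsWithin_mono t inter_subset_right)
  · rw [piecewise_eq_of_notMem _ _ _ self_notMem_Iio]
    exact (hz t ⟨le_rfl, ht.1.2⟩).mono_left (nhdsWithin_mono t hright)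

lemma eqOn_piecewise_Iio {X : Type*} [TopologicalSpace X] [T2Space X] {x z : ℝ → X} {a T : ℝ}
    {I : Set ℝ} (hx : ContinuousOn x I) (haT : a < T) (haI : Ico a T ⊆ I) (hIT : I ⊆ Iic T)
    (hlim : Tendsto x (𝓝[<] T) (𝓝 (z T))) : EqOn x ((Iio T).piecewise x z) I := by
  intro t ht
  rcases (mem_Iic.1 (hIT ht)).lt_or_eq with htT | rfl
  · simp [htT]
  · have hleft : Tendsto x (𝓝[<] t) (𝓝 (x t)) := by
      rw [← nhdsWithin_Ico_eq_nhdsLT haT]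
      exact (hx t ht).mono haI
    simpa using tendsto_nhds_unique hleft hlim

lemma isInterval_Ico {a b : ℝ} (hab : a < b) : IsInterval (Ico a b) :=
  ⟨isConnected_Ico hab, by simp [hab]⟩

lemma IsInterval.exists_lt_of_subset_Iic {I : Set ℝ} (hI : IsInterval I) {T : ℝ} (hIT : I ⊆ Iic T) :
    ∃ a ∈ I, a < T := by
  by_contra! h
  have hsub : I ⊆ {T} := fun t ht => le_antisymm (hIT ht) (h t ht)
  exact hI.2 (MeasureTheory.measure_mono_null hsub (by simp))

lemma lt_supTime_iff {I : Set ℝ} {t : ℝ} : (t : EReal) < supTime I ↔ ∃ s ∈ I, t < s := by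
  simp [supTime, lt_sSup_iff]

lemma Ico_subset_of_le_supTime {I : Set ℝ} (hI : I.OrdConnected) {a T : ℝ} (ha : a ∈ I)
    (hT : (T : EReal) ≤ supTime I) : Ico a T ⊆ I := fun s hs => by
  obtain ⟨t, ht, hst⟩ := lt_supTime_iff.1 ((EReal.coe_lt_coe_iff.2 hs.2).trans_le hT)
  exact hI.out ha ht ⟨hs.1, hst.le⟩

variable {n : ℕ} {F : State n × ℝ → Set (State n)} {x z : ℝ → State n} {I J : Set ℝ}

lemma IsGeneralizedSolution.mono (hx : IsGeneralizedSolution F x I) (hJ : IsInterval J)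
    (hJI : J ⊆ I) : IsGeneralizedSolution F x J where
  interval := hJ
  nonneg := hJI.trans hx.nonneg
  acgStar := hx.acgStar.mono hJI
  inclusion := by
    filter_upwards [hx.inclusion] with t ht htJ
    obtain ⟨v, hv, hderiv⟩ := ht (hJI htJ)
    exact ⟨v, hv, hderiv.mono hJI⟩

lemma isGeneralizedSolution_of_lipschitzOnWith (hJ : IsInterval J) (hJ₀ : J ⊆ Ici 0) {M : ℝ≥0}
    (hz : LipschitzOnWith M z J)
    (hzF : ∀ᵐ t, t ∈ J → ∃ v ∈ F (z t, t), HasDerivWithinAt z v J t) :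
    IsGeneralizedSolution F z J :=
  ⟨hJ, hJ₀, acgStarOn_of_lipschitzOnWith hz hJ.1.isPreconnected.ordConnected, hzF⟩

theorem IsGeneralizedSolution.concat {a T c : ℝ} (haT : a < T) (hTc : T < c)
    (hx : IsGeneralizedSolution F x (Ico a T)) (hz : IsGeneralizedSolution F z (Ico T c))
    (hlim : Tendsto x (𝓝[<] T) (𝓝 (z T))) :
    IsGeneralizedSolution F ((Iio T).piecewise x z) (Ico a c) := by
  have hyx : EqOn ((Iio T).piecewise x z) x (Ico a T) :=
    (piecewise_eqOn _ _ _).mono fun _ ht => ht.2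
  have hyz : EqOn ((Iio T).piecewise x z) z (Ico T c) :=
    (piecewise_eqOn_compl _ _ _).mono fun _ ht => not_lt.2 ht.1
  have hunion : Ico a T ∪ Ico T c = Ico a c := Ico_union_Ico_eq_Ico haT.le hTc.le
  refine ⟨isInterval_Ico (haT.trans hTc), ?_, ?_, ?_⟩
  · rw [← hunion]
    exact union_subset hx.nonneg hz.nonneg
  · have hcont := continuousOn_piecewise_Iio hx.acgStar.1 hz.acgStar.1 hlim
    rw [← hunion] at hcont ⊢
    exact (hx.acgStar.congr ordConnected_Ico hyx).union (hz.acgStar.congr ordConnected_Ico hyz)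
      hcont
  · filter_upwards [hx.inclusion, hz.inclusion, MeasureTheory.Measure.ae_ne MeasureTheory.volume T]
      with t htx htz hne ht
    rcases hne.lt_or_gt with htT | hTt
    · have htI : t ∈ Ico a T := ⟨ht.1, htT⟩
      obtain ⟨v, hv, hderiv⟩ := htx htI
      refine ⟨v, by rwa [hyx htI], (hderiv.congr hyx (hyx htI)).mono_of_mem_nhdsWithin ?_⟩
      filter_upwards [self_mem_nhdsWithin, mem_nhdsWithin_of_mem_nhds (Iio_mem_nhds htT)]
        with s hs hsT using ⟨hs.1, hsT⟩
    · have htI : t ∈ Ico T c := ⟨hTt.le, ht.2⟩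
      obtain ⟨v, hv, hderiv⟩ := htz htI
      refine ⟨v, by rwa [hyz htI], (hderiv.congr hyz (hyz htI)).mono_of_mem_nhdsWithin ?_⟩
      filter_upwards [self_mem_nhdsWithin, mem_nhdsWithin_of_mem_nhds (Ioi_mem_nhds hTt)]
        with s hs hTs using ⟨hTs.le, hs.2⟩

lemma exists_isGeneralizedSolution_Ico {T : ℝ} (hT : 0 ≤ T) {l : State n}
    {K : Set (State n × ℝ)} (hK : IsCompact K) (hKn : K ∈ 𝓝[univ ×ˢ Ioi T] (l, T))
    (huhc : UpperHemicontinuousOn F K)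
    (hval : ∀ p ∈ K, (F p).Nonempty ∧ IsCompact (F p) ∧ Convex ℝ (F p)) :
    ∃ c > T, ∃ z, IsGeneralizedSolution F z (Ico T c) ∧ z T = l := by
  obtain ⟨c, hTc, M, z, hz, hzT, hzF⟩ := exists_lipschitzWith_solution hK hKn huhc hval
  refine ⟨c, hTc, z, isGeneralizedSolution_of_lipschitzOnWith (isInterval_Ico hTc)
    (fun t ht => hT.trans ht.1) hz.lipschitzOnWith ?_, hzT⟩
  filter_upwards [hzF, MeasureTheory.Measure.ae_ne MeasureTheory.volume T] with t ht hne htI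
  obtain ⟨v, hv, hderiv⟩ := ht ⟨lt_of_le_of_ne htI.1 hne.symm, htI.2⟩
  exact ⟨v, hv, hderiv.hasDerivWithinAt⟩

end GeneralizedSolution

lemma exists_isCompact_subset_mem_nhdsWithin {X : Type*} [TopologicalSpace X]
    [LocallyCompactSpace X] {C S : Set X} {p : X} (hC : IsClosed C) (hS : S ∈ 𝓝[C] p) :
    ∃ K ∈ 𝓝[C] p, K ⊆ S ∧ IsCompact K := by
  obtain ⟨U, hU, hUS⟩ := mem_nhdsWithin_iff_exists_mem_nhds_inter.1 hS
  obtain ⟨N, hN, hNU, hNc⟩ := local_compact_nhds hU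
  exact ⟨N ∩ C, inter_mem (mem_nhdsWithin_of_mem_nhds hN) self_mem_nhdsWithin,
    (inter_subset_inter_left C hNU).trans hUS, hNc.inter_right hC⟩

end GenFilippov

open GenFilippov in
theorem mainTheorem2_general {n : ℕ} {T : ℝ} {F : State n × ℝ → Set (State n)} {l : State n}
    {S : Set (State n × ℝ)} (hS : S ∈ 𝓝[univ ×ˢ Ici T] (l, T))
    (husc : ∀ K ⊆ S, IsCompact K → UpperHemicontinuousOn F K)
    (hval : ∀ p ∈ S, (F p).Nonempty ∧ IsCompact (F p) ∧ Convex ℝ (F p))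
    {x : ℝ → State n} {I : Set ℝ} (hx : IsMaximalGeneralizedSolution F x I)
    (hsup : (T : EReal) ≤ supTime I) (hlim : Tendsto x (𝓝[I \ {T}] T) (𝓝 l)) :
    ∃ δ : ℝ, 0 < δ ∧ ((T + δ : ℝ) : EReal) ≤ supTime I := by
  obtain ⟨hsol, hmax⟩ := hx
  suffices hlt : (T : EReal) < supTime I by
    obtain ⟨r, hTr, hr⟩ := EReal.lt_iff_exists_real_btwn.1 hlt
    exact ⟨r - T, sub_pos.2 (EReal.coe_lt_coe_iff.1 hTr), by simpa using hr.le⟩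
  by_contra hnot
  have hIT : I ⊆ Iic T := fun t ht => not_lt.1 fun hTt => hnot (lt_supTime_iff.2 ⟨t, ht, hTt⟩)
  obtain ⟨a, haI, haT⟩ := hsol.interval.exists_lt_of_subset_Iic hIT
  have hIco : Ico a T ⊆ I :=
    Ico_subset_of_le_supTime hsol.interval.1.isPreconnected.ordConnected haI hsup
  have hleft : Tendsto x (𝓝[<] T) (𝓝 l) := by
    rw [← nhdsWithin_Ico_eq_nhdsLT haT]
    exact hlim.mono_left (nhdsWithin_mono T fun s hs => ⟨hIco hs, hs.2.ne⟩)
  obtain ⟨K, hKn, hKS, hK⟩ :=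
    exists_isCompact_subset_mem_nhdsWithin (isClosed_univ.prod isClosed_Ici) hS
  obtain ⟨c, hTc, z, hz, rfl⟩ := exists_isGeneralizedSolution_Ico ((hsol.nonneg haI).trans haT.le)
    hK (nhdsWithin_mono _ (prod_mono_right Ioi_subset_Ici_self) hKn) (husc K hKS hK)
    fun p hp => hval p (hKS hp)
  have hy := (hsol.mono (isInterval_Ico haT) hIco).concat haT hTc hz hleft
  obtain ⟨s, hTs, hsc⟩ := exists_between hTc
  exact hmax ⟨_, _, hy, ⟨a, ⟨le_rfl, haT.trans hTc⟩, haI⟩,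
    (not_lt.1 hnot).trans_lt (lt_supTime_iff.2 ⟨s, ⟨(haT.trans hTs).le, hsc⟩, hTs⟩),
    (eqOn_piecewise_Iio hsol.acgStar.1 haT hIco hIT hleft).mono inter_subset_left⟩

theorem mainTheorem2 {n : ℕ} (T ε : ℝ) (hT : 0 < T) (hε : 0 < ε)
    (F : GenFilippov.State n × ℝ → Set (GenFilippov.State n))
    (husc : ∀ K : Set (GenFilippov.State n × ℝ),
      K ⊆ Set.univ ×ˢ Set.Ico T (T + ε) → IsCompact K → UpperHemicontinuousOn F K)
    (hval : ∀ p ∈ (Set.univ : Set (GenFilippov.State n)) ×ˢ Set.Ico T (T + ε),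
      (F p).Nonempty ∧ IsCompact (F p) ∧ Convex ℝ (F p))
    (x : ℝ → GenFilippov.State n) (I : Set ℝ)
    (hx : GenFilippov.IsMaximalGeneralizedSolution F x I)
    (hsup : (T : EReal) ≤ GenFilippov.supTime I)
    (hlim : ∃ l : GenFilippov.State n,
      Filter.Tendsto x (nhdsWithin T (I \ {T})) (nhds l)) :
    ∃ δ : ℝ, 0 < δ ∧ ((T + δ : ℝ) : EReal) ≤ GenFilippov.supTime I := by
  obtain ⟨l, hl⟩ := hlim
  have hnhds : univ ×ˢ Ico T (T + ε) ∈ 𝓝[univ ×ˢ Ici T] (l, T) := by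
    rw [nhdsWithin_prod_eq]
    exact prod_mem_prod self_mem_nhdsWithin (Ico_mem_nhdsGE (lt_add_of_pos_right T hε))
  exact mainTheorem2_general hnhds husc hval hx hsup hl
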